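/- Let $n\ge 3$ advertisers take part in a second price auction (ties broken uniformly at random) in which everyone bids her current estimate of her value. The initial estimates $v_1,\dots,v_n$ are independent draws from a probability distribution $F$ on $\mathbb R$ that has a continuous cdf (for instance, a density) and a finite mean. For $v^*\in\mathbb R$ and $\delta,r>0$, a $(v^*,\delta)$-refinement signal with noise in $[-r,r]$ leaves an estimate $v\notin[v^*-\delta,v^*+\delta]$ unchanged and refines an estimate $v\in[v^*-\delta,v^*+\delta]$ to $v+\varepsilon$, where $\varepsilon$ is drawn from some distribution (which may depend measurably on $v$ and is the same for all advertisers) that is supported in $[-r,r]$, has mean zero and is not the point mass at $0$; the draws of different advertisers are independent. The value of the data to advertiser $i$ is her expected payoff when all $n$ advertisers have the signal (and bid the refined estimates) minus her expected payoff when none of them has it (and they bid the initial estimates), where in both cases the winner's payoff is her refined estimate minus the highest competing bid. Then there is a threshold $\tau$, depending only on $n$ and $F$, in the interior of the smallest interval that contains the support of $F$ (hence in the interior of the support of $F$ whenever that support is an interval), such that for every $v^*$ in the support of $F$ there is an $r>0$ with the following property: for every $\delta\in(0,r)$ and every $(v^*,\delta)$-refinement signal with noise in $[-r,r]$, the value of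 the data to every advertiser is positive if $v^*>\tau$ and negative if $v^*<\tau$. -/

import Mathlib

open MeasureTheory ProbabilityTheory Set
open scoped ENNReal

noncomputable section

/-- `Q v` is the law of the refined estimate of an advertiser whose initial estimate is `v`.
`IsRefinementSignal vstar δ r Q` says that the signal is uninformative when
`v ∉ [vstar - δ, vstar + δ]`, and that it moves the estimate to `v + ε` when
`v ∈ [vstar - δ, vstar + δ]`, where the law `ν` of `ε` (which may depend on `v`) has mean zero,
is supported in `[-r, r]`, and is not the point mass at `0`. -/
structure IsRefinementSignal (vstar δ r : ℝ) (Q : Kernel ℝ ℝ) : Prop where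
  outside : ∀ v ∉ Icc (vstar - δ) (vstar + δ), Q v = Measure.dirac v
  inside : ∀ v ∈ Icc (vstar - δ) (vstar + δ), ∃ ν : Measure ℝ,
    IsProbabilityMeasure ν ∧ (∀ᵐ e ∂ν, e ∈ Icc (-r) r) ∧ ∫ e, e ∂ν = 0 ∧
      ν ≠ Measure.dirac 0 ∧ Q v = ν.map (fun e => v + e)

/-- The highest bid among the competitors of advertiser `i`. -/
def highestCompetingBid {n : ℕ} (b : Fin n → ℝ) (i : Fin n) : ℝ :=
  ⨆ j : {j : Fin n // j ≠ i}, b j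

/-- The set of advertisers who have placed the highest bid. -/
def highestBidders {n : ℕ} (b : Fin n → ℝ) : Finset (Fin n) :=
  Finset.univ.filter fun i => ∀ j, b j ≤ b i

/-- Quasilinear payoff of advertiser `i` in the second price auction, when the values are `x` and
the bids are `b`; ties are broken uniformly at random. -/
def secondPricePayoff {n : ℕ} (x b : Fin n → ℝ) (i : Fin n) : ℝ :=
  if i ∈ highestBidders b then
    (x i - highestCompetingBid b i) / ((highestBidders b).card : ℝ)
  else 0

/-- Joint law of the pairs (initial estimate, refined estimate) of `n` symmetric advertisers: the
pairs are independent, each initial estimate has law `μ`, and the refined estimate is drawn from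
the signal `Q` given the initial one. -/
def estimatesLaw (n : ℕ) (μ : Measure ℝ) (Q : Kernel ℝ ℝ) : Measure (Fin n → ℝ × ℝ) :=
  Measure.pi fun _ => μ ⊗ₘ Q

/-- Expected payoff of advertiser `i` when all advertisers have the data: everyone bids the
refined estimate. -/
def payoffWithData (n : ℕ) (μ : Measure ℝ) (Q : Kernel ℝ ℝ) (i : Fin n) : ℝ :=
  ∫ ω, secondPricePayoff (fun j => (ω j).2) (fun j => (ω j).2) i ∂(estimatesLaw n μ Q)

/-- Expected payoff of advertiser `i` when no advertiser has the data: everyone bids the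
initial estimate (the value of winning is still the refined one). -/
def payoffWithoutData (n : ℕ) (μ : Measure ℝ) (Q : Kernel ℝ ℝ) (i : Fin n) : ℝ :=
  ∫ ω, secondPricePayoff (fun j => (ω j).2) (fun j => (ω j).1) i ∂(estimatesLaw n μ Q)

/-- The value to advertiser `i` of the data when it is given to all advertisers. -/
def dataValue (n : ℕ) (μ : Measure ℝ) (Q : Kernel ℝ ℝ) (i : Fin n) : ℝ :=
  payoffWithData n μ Q i - payoffWithoutData n μ Q i

end

/-! Let `F` and `G` be the cdfs of the initial and the refined estimate. An advertiser who bids her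
estimate expects the positive part of its excess over the highest competing bid, and by the
layer-cake formula this is the integral of `φ(cdf)`, where `φ p = p ^ (n - 1) * (1 - p)`. Without
the data the winner also collects her noise, which has mean zero given all initial estimates. So the
value of the data is `∫ (φ(G) - φ(F))` (`dataValue_eq`).

`G` is a mean-preserving spread of `F`, and it differs from `F` only near `v*`. If `φ` is strictly
concave on the range of `F` there, then `φ(G) - φ(F) ≥ φ'(G) (G - F)`. The integral of the right
side is nonnegative, because `φ' ∘ G` is antitone and a mean-preserving spread makes `∫ k (G - F) ≥
0` for antitone `k` (`setIntegral_antitone_mul_cdf_sub_nonneg`). The inequality is strict as the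
noise is not degenerate (`setIntegral_comp_cdf_sub_pos`). If `φ` is strictly convex there, the same
argument for `-φ` reverses the sign.

The only inflection point of `φ` in `(0, 1)` is `(n - 2) / n`, with convexity below and concavity
above. The threshold `τ` is therefore a quantile of `F` at that level. -/

/-! ### Local mean-preserving spreads and their distribution functions -/

/-- The difference of the indicators of `x₂ ≤ x` and of `x₁ ≤ x`. -/
noncomputable def stepDiff (p : ℝ × ℝ) (x : ℝ) : ℝ :=
  (if p.2 ≤ x then 1 else 0) - (if p.1 ≤ x then 1 else 0)

lemma abs_stepDiff_le (p : ℝ × ℝ) (x : ℝ) : |stepDiff p x| ≤ 1 := by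
  unfold stepDiff
  split_ifs <;> simp

lemma measurable_stepDiff : Measurable fun q : ℝ × (ℝ × ℝ) => stepDiff q.2 q.1 := by
  unfold stepDiff
  refine Measurable.sub ?_ ?_ <;>
    refine Measurable.ite (measurableSet_le (by fun_prop) (by fun_prop)) ?_ ?_ <;> fun_prop

lemma integral_stepDiff (P : Measure (ℝ × ℝ)) [IsProbabilityMeasure P] (x : ℝ) :
    ∫ p, stepDiff p x ∂P = P.real {p | p.2 ≤ x} - P.real {p | p.1 ≤ x} := by
  have h2 : MeasurableSet {p : ℝ × ℝ | p.2 ≤ x} := measurableSet_le (by fun_prop) (by fun_prop)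
  have h1 : MeasurableSet {p : ℝ × ℝ | p.1 ≤ x} := measurableSet_le (by fun_prop) (by fun_prop)
  have e : ∀ p : ℝ × ℝ, stepDiff p x
      = {p : ℝ × ℝ | p.2 ≤ x}.indicator 1 p - {p : ℝ × ℝ | p.1 ≤ x}.indicator 1 p := by
    intro p
    simp [stepDiff, indicator_apply]
  simp_rw [e]
  have i : ∀ s : Set (ℝ × ℝ), MeasurableSet s → Integrable (s.indicator (1 : ℝ × ℝ → ℝ)) P :=
    fun s hs => (integrable_const (1 : ℝ)).indicator hs
  rw [integral_sub (i _ h2) (i _ h1), integral_indicator_one h2, integral_indicator_one h1]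

lemma setIntegral_Icc_step {a b c : ℝ} (hc : c ∈ Icc a b) :
    ∫ x in Icc a b, (if c ≤ x then (1 : ℝ) else 0) = b - c := by
  have e : (fun x : ℝ => if c ≤ x then (1 : ℝ) else 0) = (Ici c).indicator 1 := by
    ext x; simp [indicator_apply]
  have s : Ici c ∩ Icc a b = Icc c b := by
    ext x; simp only [mem_inter_iff, mem_Ici, mem_Icc]
    exact ⟨fun h => ⟨h.1, h.2.2⟩, fun h => ⟨h.1, hc.1.trans h.1, h.2⟩⟩
  rw [e, integral_indicator_one measurableSet_Ici, measureReal_restrict_apply measurableSet_Ici, s,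
    Real.volume_real_Icc_of_le hc.2]

lemma integrableOn_step (a b c : ℝ) :
    IntegrableOn (fun x : ℝ => if c ≤ x then (1 : ℝ) else 0) (Icc a b) := by
  have e : (fun x : ℝ => if c ≤ x then (1 : ℝ) else 0) = (Ici c).indicator 1 := by
    ext x; simp [indicator_apply]
  rw [e]
  exact (integrable_const (1 : ℝ)).indicator measurableSet_Ici

lemma setIntegral_stepDiff {a b : ℝ} {p : ℝ × ℝ}
    (hp : p.2 = p.1 ∨ (p.1 ∈ Icc a b ∧ p.2 ∈ Icc a b)) :
    ∫ x in Icc a b, stepDiff p x = p.1 - p.2 := by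
  rcases hp with h | ⟨h1, h2⟩
  · simp [stepDiff, h]
  · unfold stepDiff
    rw [integral_sub (integrableOn_step a b _) (integrableOn_step a b _),
      setIntegral_Icc_step h1, setIntegral_Icc_step h2]
    ring

/-- A law of pairs (initial estimate, refined estimate), in which the refinement has conditional
mean zero and takes place inside the interval `[a, b]`. -/
structure IsLocalRefinement (P : Measure (ℝ × ℝ)) (a b : ℝ) : Prop where
  local_ae : ∀ᵐ p ∂P, p.2 = p.1 ∨ (p.1 ∈ Ioo a b ∧ p.2 ∈ Ioo a b)
  integral_eq_zero : ∀ g : ℝ → ℝ, Measurable g → (∃ C, ∀ x, |g x| ≤ C) →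
    ∫ p, g p.1 * (p.2 - p.1) ∂P = 0

lemma cdf_eq_of_notMem {P : Measure (ℝ × ℝ)} {a b : ℝ} (hP : IsLocalRefinement P a b) {x : ℝ} (hx : x ∉ Ioo a b) :
    P.real {p | p.2 ≤ x} = P.real {p | p.1 ≤ x} := by
  refine measureReal_congr ?_
  filter_upwards [hP.local_ae] with p hp
  refine propext ?_
  change p.2 ≤ x ↔ p.1 ≤ x
  rcases hp with h | ⟨h1, h2⟩
  · rw [h]
  · rw [mem_Ioo, not_and_or, not_lt, not_lt] at hx
    rcases hx with hx | hx
    · exact iff_of_false (by linarith [h2.1]) (by linarith [h1.1])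
    · exact iff_of_true (by linarith [h2.2]) (by linarith [h1.2])

section

variable {P : Measure (ℝ × ℝ)} [IsProbabilityMeasure P] {a b : ℝ}

lemma integrable_mul_stepDiff {k : ℝ × ℝ × ℝ → ℝ} (hk : Measurable k) {C : ℝ}
    (hC : ∀ q, |k q| ≤ C) (m : Measure (ℝ × ℝ × ℝ)) [IsFiniteMeasure m] :
    Integrable (fun q : ℝ × (ℝ × ℝ) => k q * stepDiff q.2 q.1) m := by
  refine Integrable.of_bound (hk.mul measurable_stepDiff).aestronglyMeasurable C
    (ae_of_all _ fun q => ?_)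
  rw [Real.norm_eq_abs, abs_mul]
  calc |k q| * |stepDiff q.2 q.1| ≤ |k q| * 1 := by gcongr; exact abs_stepDiff_le _ _
    _ ≤ C := by simpa using hC q

lemma integrable_integral_mul_stepDiff {k : ℝ × ℝ × ℝ → ℝ} (hk : Measurable k) {C : ℝ}
    (hC : ∀ q, |k q| ≤ C) :
    Integrable (fun p => ∫ x in Icc a b, k (x, p) * stepDiff p x) P :=
  (integrable_mul_stepDiff hk hC ((volume.restrict (Icc a b)).prod P)).integral_prod_right

/-- Fubini writes the cdf difference as the mean of `stepDiff`. Subtracting `k p.1` is free, because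
`stepDiff p` integrates to `p.1 - p.2`, which is orthogonal to bounded functions of `p.1`. -/
lemma setIntegral_mul_cdf_sub (hP : IsLocalRefinement P a b) {k : ℝ → ℝ} (hk : Measurable k)
    {C : ℝ} (hC : ∀ x, |k x| ≤ C) :
    ∫ x in Icc a b, k x * (P.real {p | p.2 ≤ x} - P.real {p | p.1 ≤ x})
      = ∫ p, (∫ x in Icc a b, (k x - k p.1) * stepDiff p x) ∂P := by
  have i1 := integrable_mul_stepDiff (k := fun q => k q.1) (by fun_prop) (fun q => hC q.1)
    ((volume.restrict (Icc a b)).prod P)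
  have e1 : ∫ x in Icc a b, k x * (P.real {p | p.2 ≤ x} - P.real {p | p.1 ≤ x})
      = ∫ p, (∫ x in Icc a b, k x * stepDiff p x) ∂P := by
    rw [← integral_integral_swap i1]
    simp_rw [← integral_stepDiff P, integral_const_mul]
  have e2 : ∫ p, (∫ x in Icc a b, k p.1 * stepDiff p x) ∂P = 0 := by
    simp_rw [integral_const_mul]
    have := hP.integral_eq_zero (fun x => - k x) hk.neg ⟨C, fun x => by simpa using hC x⟩
    rw [← this]
    refine integral_congr_ae ?_
    filter_upwards [hP.local_ae] with p hp
    rw [setIntegral_stepDiff (hp.imp_right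
      fun h => ⟨Ioo_subset_Icc_self h.1, Ioo_subset_Icc_self h.2⟩)]
    ring
  rw [e1, ← sub_zero (∫ p, _ ∂P), ← e2, ← integral_sub
    (integrable_integral_mul_stepDiff (k := fun q => k q.1) (by fun_prop) (fun q => hC q.1))
    (integrable_integral_mul_stepDiff (k := fun q => k q.2.1) (by fun_prop) (fun q => hC q.2.1))]
  refine integral_congr_ae (ae_of_all _ fun p => ?_)
  have j : ∀ l : ℝ → ℝ, Measurable l → (∀ x, |l x| ≤ C) →
      Integrable (fun x => l x * stepDiff p x) (volume.restrict (Icc a b)) := by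
    intro l hl hlC
    refine Integrable.of_bound (hl.mul
      (measurable_stepDiff.comp (measurable_id.prodMk measurable_const))).aestronglyMeasurable C
      (ae_of_all _ fun q => ?_)
    rw [Real.norm_eq_abs, abs_mul]
    calc |l q| * |stepDiff p q| ≤ |l q| * 1 := by gcongr; exact abs_stepDiff_le _ _
      _ ≤ C := by simpa using hlC q
  simp only [sub_mul]
  exact (integral_sub (j k hk hC) (j (fun _ => k p.1) measurable_const fun _ => hC p.1)).symm

/-- `stepDiff p` is `1` only for `p.2 ≤ x < p.1` and `-1` only for `p.1 ≤ x < p.2`; in both cases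
the sign agrees with that of `k x - k p.1`. -/
lemma antitone_sub_mul_stepDiff_nonneg {k : ℝ → ℝ} (hk : Antitone k) (p : ℝ × ℝ) (x : ℝ) :
    0 ≤ (k x - k p.1) * stepDiff p x := by
  unfold stepDiff
  split_ifs with h2 h1 h1
  · simp
  · simpa using hk (not_le.1 h1).le
  · simpa using hk h1
  · simp

/-- Integrating an antitone function against the difference of the two distribution functions. -/
lemma setIntegral_antitone_mul_cdf_sub_nonneg (hP : IsLocalRefinement P a b) {k : ℝ → ℝ}
    (hk : Antitone k) {C : ℝ} (hC : ∀ x, |k x| ≤ C) :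
    0 ≤ ∫ x in Icc a b, k x * (P.real {p | p.2 ≤ x} - P.real {p | p.1 ≤ x}) := by
  rw [setIntegral_mul_cdf_sub hP hk.measurable hC]
  exact integral_nonneg fun p => integral_nonneg fun x => antitone_sub_mul_stepDiff_nonneg hk p x

/-- Projection of the real line to `[a, b]`. -/
noncomputable def clamp (a b x : ℝ) : ℝ := max a (min b x)

lemma clamp_mono : Monotone (clamp a b) := fun _ _ h => max_le_max le_rfl (min_le_min le_rfl h)

lemma clamp_of_mem {x : ℝ} (hx : x ∈ Icc a b) : clamp a b x = x := by
  simp [clamp, hx.1, hx.2]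

lemma clamp_mem (hab : a ≤ b) (x : ℝ) : clamp a b x ∈ Icc a b :=
  ⟨le_max_left _ _, max_le hab (min_le_left _ _)⟩

/-- On `[a, b]` the clamp is the identity, so the integral equals `(p.2 - p.1) ^ 2 / 2`. It serves
to detect nondegenerate noise. -/
lemma setIntegral_clamp_sub_mul_stepDiff_pos {p : ℝ × ℝ} (h1 : p.1 ∈ Ioo a b)
    (h2 : p.2 ∈ Ioo a b) (hne : p.2 ≠ p.1) :
    0 < ∫ x in Icc a b, (-clamp a b x - -clamp a b p.1) * stepDiff p x := by
  have hab : a ≤ b := (h1.1.trans h1.2).le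
  have hanti : Antitone fun x => -clamp a b x := fun _ _ h => neg_le_neg (clamp_mono h)
  rw [integral_pos_iff_support_of_nonneg
    (fun x => antitone_sub_mul_stepDiff_nonneg (k := fun x => -clamp a b x) hanti p x)]
  · have hs : Ioo (min p.1 p.2) (max p.1 p.2) ⊆ Function.support
        (fun x => (-clamp a b x - -clamp a b p.1) * stepDiff p x) ∩ Icc a b := by
      intro x hx
      have hxI : x ∈ Icc a b :=
        ⟨(le_min h1.1.le h2.1.le).trans hx.1.le, hx.2.le.trans (max_le h1.2.le h2.2.le)⟩
      refine ⟨?_, hxI⟩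
      rw [Function.mem_support, clamp_of_mem hxI, clamp_of_mem (Ioo_subset_Icc_self h1)]
      unfold stepDiff
      rcases lt_or_gt_of_ne hne with h | h
      · rw [min_eq_right h.le, max_eq_left h.le] at hx
        rw [if_pos hx.1.le, if_neg (not_le.2 hx.2)]
        have := hx.2
        norm_num
        linarith
      · rw [min_eq_left h.le, max_eq_right h.le] at hx
        rw [if_pos hx.1.le, if_neg (not_le.2 hx.2)]
        have := hx.1
        norm_num
        linarith
    rw [Measure.restrict_apply' measurableSet_Icc]
    refine lt_of_lt_of_le ?_ (measure_mono hs)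
    rw [Real.volume_Ioo]
    simp only [ENNReal.ofReal_pos, sub_pos, min_lt_max]
    exact hne.symm
  · refine Integrable.of_bound (C := |b - a|) (Measurable.aestronglyMeasurable ?_)
      (ae_of_all _ fun x => ?_)
    · exact (clamp_mono.measurable.neg.sub_const _).mul
        (measurable_stepDiff.comp (measurable_id.prodMk measurable_const))
    · have u := clamp_mem hab x
      have v := clamp_mem hab p.1
      rw [Real.norm_eq_abs, abs_mul]
      calc _ ≤ |-clamp a b x - -clamp a b p.1| * 1 := by gcongr; exact abs_stepDiff_le _ _
        _ ≤ |b - a| := by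
          rw [mul_one, abs_of_nonneg (sub_nonneg.2 hab), abs_le]
          constructor <;> linarith [u.1, u.2, v.1, v.2]

/-- Equal cdfs, tested against `k x = -x` on `[a, b]`, would make the mean square of the noise
vanish. -/
lemma not_ae_cdf_eq (hab : a ≤ b) (hP : IsLocalRefinement P a b)
    (hne : ¬ ∀ᵐ p ∂P, p.2 = p.1) :
    ¬ ∀ᵐ x ∂(volume.restrict (Icc a b)), P.real {p | p.2 ≤ x} = P.real {p | p.1 ≤ x} := by
  intro h
  have hanti : Antitone fun x => -clamp a b x := fun _ _ h => neg_le_neg (clamp_mono h)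
  have hC : ∀ x, |-clamp a b x| ≤ max |a| |b| := fun x => by
    rw [abs_neg]
    exact abs_le_max_abs_abs (clamp_mem hab x).1 (clamp_mem hab x).2
  have e := setIntegral_mul_cdf_sub hP hanti.measurable hC
  have z : ∫ x in Icc a b, -clamp a b x * (P.real {p | p.2 ≤ x} - P.real {p | p.1 ≤ x}) = 0 := by
    rw [← integral_zero ℝ ℝ (μ := volume.restrict (Icc a b))]
    refine integral_congr_ae ?_
    filter_upwards [h] with x hx
    simp [hx]
  rw [z] at e
  have e' := (integral_eq_zero_iff_of_nonneg (fun p => integral_nonneg fun x =>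
    antitone_sub_mul_stepDiff_nonneg hanti p x) (integrable_integral_mul_stepDiff
      (k := fun q => -clamp a b q.1 - -clamp a b q.2.1)
      ((clamp_mono.measurable.comp measurable_fst).neg.sub
        (clamp_mono.measurable.comp (measurable_fst.comp measurable_snd)).neg)
      (C := max |a| |b| + max |a| |b|)
      (fun q => (abs_sub _ _).trans (add_le_add (hC _) (hC _))))).1 e.symm
  apply hne
  filter_upwards [e', hP.local_ae] with p hp hl
  rcases hl with hl | ⟨h1, h2⟩
  · exact hl
  · by_contra hc
    exact (setIntegral_clamp_sub_mul_stepDiff_pos h1 h2 hc).ne' hp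

lemma cdf_mono {f : ℝ × ℝ → ℝ} : Monotone fun x => P.real {p | f p ≤ x} :=
  fun _ _ h => measureReal_mono fun _ hp => le_trans hp h

/-- A local refinement increases the integral of a strictly concave function of the distribution
function. -/
lemma setIntegral_comp_cdf_sub_pos (hab : a ≤ b) (hP : IsLocalRefinement P a b)
    (hne : ¬ ∀ᵐ p ∂P, p.2 = p.1) {φ φ' : ℝ → ℝ} (hφ : Continuous φ)
    (hφ' : Continuous φ')
    (hanti : AntitoneOn φ' (Icc (P.real {p | p.1 ≤ a}) (P.real {p | p.1 ≤ b})))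
    (hslope : ∀ p ∈ Icc (P.real {p | p.1 ≤ a}) (P.real {p | p.1 ≤ b}),
      ∀ q ∈ Icc (P.real {p | p.1 ≤ a}) (P.real {p | p.1 ≤ b}), p ≠ q →
        φ' q * (q - p) < φ q - φ p) :
    0 < ∫ x in Icc a b, (φ (P.real {p | p.2 ≤ x}) - φ (P.real {p | p.1 ≤ x})) := by
  set F : ℝ → ℝ := fun x => P.real {p | p.1 ≤ x} with hF
  set G : ℝ → ℝ := fun x => P.real {p | p.2 ≤ x} with hG
  have hFm : Monotone F := cdf_mono
  have hGm : Monotone G := cdf_mono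
  have hGa : G a = F a := cdf_eq_of_notMem hP (by simp)
  have hGb : G b = F b := cdf_eq_of_notMem hP (by simp)
  have hFI : ∀ x ∈ Icc a b, F x ∈ Icc (F a) (F b) := fun x hx => ⟨hFm hx.1, hFm hx.2⟩
  -- The two cdfs agree at `a` and `b`, so concavity is needed only between `F a` and `F b`.
  have hGI : ∀ x ∈ Icc a b, G x ∈ Icc (F a) (F b) := fun x hx =>
    ⟨hGa ▸ hGm hx.1, hGb ▸ hGm hx.2⟩
  have hint : ∀ (ψ : ℝ → ℝ) (H : ℝ → ℝ), Continuous ψ → Monotone H →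
      (∀ x, H x ∈ Icc (0 : ℝ) 1) → ∃ C, ∀ x, |ψ (H x)| ≤ C := by
    intro ψ H hψ _ hH
    obtain ⟨C, hC⟩ := isCompact_Icc.exists_bound_of_continuousOn (s := Icc (0 : ℝ) 1)
      hψ.continuousOn
    exact ⟨C, fun x => hC _ (hH x)⟩
  have hF01 : ∀ x, F x ∈ Icc (0 : ℝ) 1 := fun x => ⟨measureReal_nonneg, measureReal_le_one⟩
  have hG01 : ∀ x, G x ∈ Icc (0 : ℝ) 1 := fun x => ⟨measureReal_nonneg, measureReal_le_one⟩
  obtain ⟨C1, hC1⟩ := hint φ G hφ hGm hG01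
  obtain ⟨C2, hC2⟩ := hint φ F hφ hFm hF01
  obtain ⟨C3, hC3⟩ := hint φ' G hφ' hGm hG01
  have i12 : IntegrableOn (fun x => φ (G x) - φ (F x)) (Icc a b) :=
    (Integrable.of_bound (hφ.measurable.comp hGm.measurable).aestronglyMeasurable C1
      (ae_of_all _ hC1)).sub (Integrable.of_bound
        (hφ.measurable.comp hFm.measurable).aestronglyMeasurable C2 (ae_of_all _ hC2))
  have i3 : IntegrableOn (fun x => φ' (G x) * (G x - F x)) (Icc a b) := by
    refine Integrable.of_bound ((hφ'.measurable.comp hGm.measurable).mul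
      (hGm.measurable.sub hFm.measurable)).aestronglyMeasurable C3 (ae_of_all _ fun x => ?_)
    rw [Real.norm_eq_abs, abs_mul]
    calc |φ' (G x)| * |G x - F x| ≤ |φ' (G x)| * 1 := by
          gcongr
          rw [abs_le]
          constructor <;> linarith [(hF01 x).1, (hF01 x).2, (hG01 x).1, (hG01 x).2]
      _ ≤ C3 := by simpa using hC3 x
  have h3 : 0 ≤ ∫ x in Icc a b, φ' (G x) * (G x - F x) := by
    -- The clamp extends `φ' ∘ G` from `[a, b]` to a globally antitone function without changing it
    -- on `[a, b]`.
    have := setIntegral_antitone_mul_cdf_sub_nonneg hP (k := fun x => φ' (G (clamp a b x)))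
      (fun x y h => hanti (hGI _ (clamp_mem hab x)) (hGI _ (clamp_mem hab y))
        (hGm (clamp_mono h))) (fun x => hC3 _)
    refine this.trans_eq (setIntegral_congr_fun measurableSet_Icc fun x hx => ?_)
    simp only [clamp_of_mem hx, hF, hG]
  -- The tangent is taken at `G x`, not at `F x`: this is what bounds `φ (G x) - φ (F x)` from
  -- below. A zero integral would force `F = G` almost everywhere on `[a, b]`.
  have hpos : 0 < ∫ x in Icc a b, (φ (G x) - φ (F x) - φ' (G x) * (G x - F x)) := by
    have hnn : 0 ≤ᵐ[volume.restrict (Icc a b)]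
        fun x => φ (G x) - φ (F x) - φ' (G x) * (G x - F x) := by
      filter_upwards [ae_restrict_mem measurableSet_Icc] with x hx
      by_cases h : F x = G x
      · simp [h]
      · have := hslope _ (hFI x hx) _ (hGI x hx) h
        simp only [Pi.zero_apply]
        linarith
    refine lt_of_le_of_ne (integral_nonneg_of_ae hnn) fun h0 => ?_
    have := (integral_eq_zero_iff_of_nonneg_ae hnn (i12.sub i3)).1 h0.symm
    apply not_ae_cdf_eq hab hP hne
    filter_upwards [this, ae_restrict_mem measurableSet_Icc] with x h0 hx
    by_contra h
    have := hslope _ (hFI x hx) _ (hGI x hx) (Ne.symm h)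
    simp only [Pi.zero_apply] at h0
    linarith
  rw [integral_sub i12 i3] at hpos
  linarith

end

/-! ### Expected payoffs in terms of the distribution function of the bids -/

section Auction

variable {n : ℕ}

lemma highestCompetingBid_le_iff (hn : 2 ≤ n) {b : Fin n → ℝ} {i : Fin n} {x : ℝ} :
    highestCompetingBid b i ≤ x ↔ ∀ j, j ≠ i → b j ≤ x := by
  have : Nontrivial (Fin n) := Fin.nontrivial_iff_two_le.2 hn
  obtain ⟨j, hj⟩ := exists_ne i
  -- With no competitor the real supremum would take the default value `0`.
  have : Nonempty {j : Fin n // j ≠ i} := ⟨⟨j, hj⟩⟩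
  unfold highestCompetingBid
  rw [ciSup_le_iff (Set.finite_range _).bddAbove]
  simp

lemma mem_highestBidders_iff (hn : 2 ≤ n) {b : Fin n → ℝ} {i : Fin n} :
    i ∈ highestBidders b ↔ highestCompetingBid b i ≤ b i := by
  rw [highestCompetingBid_le_iff hn]
  simp only [highestBidders, Finset.mem_filter, Finset.mem_univ, true_and]
  refine ⟨fun h j _ => h j, fun h j => ?_⟩
  by_cases hj : j = i
  · rw [hj]
  · exact h j hj

lemma le_highestCompetingBid (hn : 2 ≤ n) {b : Fin n → ℝ} {i j : Fin n} (hj : j ≠ i) :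
    b j ≤ highestCompetingBid b i :=
  (highestCompetingBid_le_iff hn).1 le_rfl j hj

/-- Probability that `i` wins when the bids are `b`. -/
noncomputable def winProb (b : Fin n → ℝ) (i : Fin n) : ℝ :=
  if i ∈ highestBidders b then ((highestBidders b).card : ℝ)⁻¹ else 0

lemma winProb_eq_one (hn : 2 ≤ n) {b : Fin n → ℝ} {i : Fin n}
    (h : highestCompetingBid b i < b i) : winProb b i = 1 := by
  have hi : i ∈ highestBidders b := (mem_highestBidders_iff hn).2 h.le
  have hs : highestBidders b = {i} := by
    refine Finset.eq_singleton_iff_unique_mem.2 ⟨hi, fun j hj => ?_⟩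
    by_contra hji
    have h1 := le_highestCompetingBid hn (b := b) hji
    have h2 : b i ≤ b j := (Finset.mem_filter.1 hj).2 i
    linarith
  unfold winProb
  rw [if_pos hi, hs]
  simp

lemma secondPricePayoff_eq_mul (x b : Fin n → ℝ) (i : Fin n) :
    secondPricePayoff x b i = (x i - highestCompetingBid b i) * winProb b i := by
  unfold secondPricePayoff winProb
  split_ifs
  · rw [div_eq_mul_inv]
  · simp

/-- A tie at the top leaves a zero surplus when the bid equals the value, so tie-breaking plays no
role. -/
lemma secondPricePayoff_self (hn : 2 ≤ n) (b : Fin n → ℝ) (i : Fin n) :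
    secondPricePayoff b b i = max (b i - highestCompetingBid b i) 0 := by
  rw [secondPricePayoff_eq_mul]
  rcases lt_trichotomy (highestCompetingBid b i) (b i) with h | h | h
  · rw [winProb_eq_one hn h, mul_one, max_eq_left (sub_nonneg.2 h.le)]
  · simp [h]
  · have : i ∉ highestBidders b := by
      rw [mem_highestBidders_iff hn]
      exact not_le.2 h
    rw [max_eq_right (sub_nonpos.2 h.le), winProb, if_neg this, mul_zero]

/-- This splits the payoff into a part that depends on the bids alone and a noise part that averages
out. -/
lemma secondPricePayoff_eq_add (hn : 2 ≤ n) (x b : Fin n → ℝ) (i : Fin n) :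
    secondPricePayoff x b i
      = max (b i - highestCompetingBid b i) 0 + (x i - b i) * winProb b i := by
  rw [← secondPricePayoff_self hn, secondPricePayoff_eq_mul, secondPricePayoff_eq_mul]
  ring

lemma abs_winProb_le (b : Fin n → ℝ) (i : Fin n) : |winProb b i| ≤ 1 := by
  unfold winProb
  split_ifs with h
  · have : (1 : ℝ) ≤ (highestBidders b).card := by
      exact_mod_cast Finset.card_pos.2 ⟨i, h⟩
    rw [abs_of_nonneg (by positivity)]
    exact inv_le_one_of_one_le₀ this
  · simp

lemma measurableSet_mem_highestBidders (i : Fin n) :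
    MeasurableSet {b : Fin n → ℝ | i ∈ highestBidders b} := by
  simp only [highestBidders, Finset.mem_filter, Finset.mem_univ, true_and, ofPred_forall]
  exact MeasurableSet.iInter fun j => measurableSet_le (measurable_pi_apply j)
    (measurable_pi_apply i)

lemma measurable_winProb (i : Fin n) : Measurable fun b : Fin n → ℝ => winProb b i := by
  unfold winProb
  refine Measurable.ite (measurableSet_mem_highestBidders i) (Measurable.inv ?_) measurable_const
  have e : (fun b : Fin n → ℝ => ((highestBidders b).card : ℝ))
      = fun b => ∑ j, if j ∈ highestBidders b then (1 : ℝ) else 0 := by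
    ext b
    simp
  rw [e]
  exact Finset.measurable_sum _ fun j _ =>
    Measurable.ite (measurableSet_mem_highestBidders j) measurable_const measurable_const

lemma measurable_highestCompetingBid (i : Fin n) :
    Measurable fun b : Fin n → ℝ => highestCompetingBid b i :=
  Measurable.iSup fun j => measurable_pi_apply j.1

/-- Layer cake: the positive part is the length of the set of `x` with `highestCompetingBid ≤ x <
own bid`, and independence factors the probability of that event. -/
lemma lintegral_ofReal_sub_highestCompetingBid {Ω : Type*} [MeasurableSpace Ω] (P : Measure Ω)
    [IsProbabilityMeasure P] (hn : 2 ≤ n) {f : Ω → ℝ} (hf : Measurable f) (i : Fin n) :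
    ∫⁻ ω, ENNReal.ofReal (f (ω i) - highestCompetingBid (fun j => f (ω j)) i)
        ∂(Measure.pi fun _ : Fin n => P)
      = ∫⁻ x, P {p | f p ≤ x} ^ (n - 1) * P {p | x < f p} := by
  set M : (Fin n → Ω) → ℝ := fun ω => highestCompetingBid (fun j => f (ω j)) i with hM
  have hfi : Measurable fun ω : Fin n → Ω => f (ω i) := hf.comp (measurable_pi_apply i)
  have hMm : Measurable M := (measurable_highestCompetingBid i).comp
    (measurable_pi_lambda _ fun j => hf.comp (measurable_pi_apply j))
  let S : Set ((Fin n → Ω) × ℝ) := {q | M q.1 ≤ q.2 ∧ q.2 < f (q.1 i)}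
  have hS : MeasurableSet S := (measurableSet_le (hMm.comp measurable_fst) measurable_snd).inter
    (measurableSet_lt measurable_snd (hfi.comp measurable_fst))
  have h1 : ∀ ω, ENNReal.ofReal (f (ω i) - M ω) = ∫⁻ x, S.indicator 1 (ω, x) := by
    intro ω
    rw [← Real.volume_Ico, ← lintegral_indicator_one measurableSet_Ico]
    rfl
  have h2 : ∀ x, ∫⁻ ω, S.indicator 1 (ω, x) ∂(Measure.pi fun _ : Fin n => P)
      = P {p | f p ≤ x} ^ (n - 1) * P {p | x < f p} := by
    intro x
    let A : Fin n → Set Ω := fun j => if j = i then {p | x < f p} else {p | f p ≤ x}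
    have e : (fun ω => S.indicator (1 : (Fin n → Ω) × ℝ → ℝ≥0∞) (ω, x))
        = (Set.pi univ A).indicator 1 := by
      ext ω
      have : (ω, x) ∈ S ↔ ω ∈ Set.pi univ A := by
        simp only [S, A, mem_ofPred_eq, hM, highestCompetingBid_le_iff hn, mem_pi, mem_univ,
          true_implies]
        constructor
        · rintro ⟨h, h'⟩ j
          by_cases hj : j = i
          · subst hj; simpa using h'
          · simpa [hj] using h j hj
        · intro h
          exact ⟨fun j hj => by simpa [hj] using h j, by simpa using h i⟩
      by_cases h : (ω, x) ∈ S
      · rw [indicator_of_mem h, indicator_of_mem (this.1 h)]; rfl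
      · rw [indicator_of_notMem h, indicator_of_notMem (fun h' => h (this.2 h'))]
    have hA : ∀ j, MeasurableSet (A j) := by
      intro j
      simp only [A]
      split_ifs
      · exact measurableSet_lt measurable_const hf
      · exact measurableSet_le hf measurable_const
    rw [e, lintegral_indicator_one (MeasurableSet.univ_pi hA), Measure.pi_pi,
      ← Finset.prod_erase_mul _ _ (Finset.mem_univ i)]
    congr 1
    · rw [Finset.prod_congr rfl (g := fun _ => P {p | f p ≤ x})]
      · simp
      · intro j hj
        simp [A, Finset.ne_of_mem_erase hj]
    · simp [A]
  rw [lintegral_congr h1]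
  rw [lintegral_lintegral_swap]
  · simp_rw [h2]
  · exact ((measurable_one.indicator hS).comp measurable_id).aemeasurable

/-- Tail term of the expected gap between the bid of an advertiser and the highest competing bid,
as a function of the value of the distribution function. -/
noncomputable def gapDensity (n : ℕ) (p : ℝ) : ℝ := p ^ (n - 1) * (1 - p)

section Expectation

variable {Ω : Type*} [MeasurableSpace Ω] {P : Measure Ω} [IsProbabilityMeasure P] {f : Ω → ℝ}

lemma integrable_max_sub_highestCompetingBid (hn : 2 ≤ n) (hf : Measurable f)
    (hfi : Integrable f P) (i : Fin n) :
    Integrable (fun ω : Fin n → Ω => max (f (ω i) - highestCompetingBid (fun j => f (ω j)) i) 0)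
      (Measure.pi fun _ => P) := by
  have : Nontrivial (Fin n) := Fin.nontrivial_iff_two_le.2 hn
  obtain ⟨j, hj⟩ := exists_ne i
  have hi : ∀ j, Integrable (fun ω : Fin n → Ω => f (ω j)) (Measure.pi fun _ => P) :=
    fun j => integrable_comp_eval (μ := fun _ => P) hfi
  -- A single competitor `j` suffices for the bound, since the highest competing bid is at least
  -- hers.
  refine ((hi i).abs.add (hi j).abs).mono' (Measurable.aestronglyMeasurable ?_)
    (ae_of_all _ fun ω => ?_)
  · exact ((hf.comp (measurable_pi_apply i)).sub ((measurable_highestCompetingBid i).comp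
      (measurable_pi_lambda _ fun j => hf.comp (measurable_pi_apply j)))).max measurable_const
  · have := le_highestCompetingBid hn (b := fun j => f (ω j)) hj
    rw [Real.norm_eq_abs, abs_of_nonneg (le_max_right _ _)]
    simp only [Pi.add_apply]
    refine max_le ?_ (by positivity)
    linarith [le_abs_self (f (ω i)), neg_abs_le (f (ω j))]

lemma ofReal_gapDensity (hf : Measurable f) (x : ℝ) :
    ENNReal.ofReal (gapDensity n (P.real {p | f p ≤ x}))
      = P {p | f p ≤ x} ^ (n - 1) * P {p | x < f p} := by
  have hs : {p | x < f p} = {p | f p ≤ x}ᶜ := by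
    ext p; simp
  rw [gapDensity, hs, ← probReal_compl_eq_one_sub (measurableSet_le hf measurable_const),
    ENNReal.ofReal_mul (by positivity), ENNReal.ofReal_pow measureReal_nonneg,
    ofReal_measureReal, ofReal_measureReal]

lemma gapDensity_nonneg {p : ℝ} (h : p ∈ Icc (0 : ℝ) 1) : 0 ≤ gapDensity n p :=
  mul_nonneg (pow_nonneg h.1 _) (sub_nonneg.2 h.2)

lemma measurable_gapDensity_cdf :
    Measurable fun x => gapDensity n (P.real {p | f p ≤ x}) := by
  have : Monotone fun x => P.real {p | f p ≤ x} :=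
    fun _ _ h => measureReal_mono fun _ hp => le_trans hp h
  have := this.measurable
  unfold gapDensity
  fun_prop

lemma lintegral_gapDensity_cdf (hn : 2 ≤ n) (hf : Measurable f) (i : Fin n) :
    ∫⁻ x, ENNReal.ofReal (gapDensity n (P.real {p | f p ≤ x}))
      = ∫⁻ ω, ENNReal.ofReal (max (f (ω i) - highestCompetingBid (fun j => f (ω j)) i) 0)
        ∂(Measure.pi fun _ : Fin n => P) := by
  simp_rw [ofReal_gapDensity hf, ENNReal.ofReal_max, ENNReal.ofReal_zero, max_eq_left zero_le]
  exact (lintegral_ofReal_sub_highestCompetingBid P hn hf i).symm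

lemma integrable_gapDensity_cdf (hn : 2 ≤ n) (hf : Measurable f) (hfi : Integrable f P) :
    Integrable fun x => gapDensity n (P.real {p | f p ≤ x}) := by
  let i : Fin n := ⟨0, by omega⟩
  refine (lintegral_ofReal_ne_top_iff_integrable measurable_gapDensity_cdf.aestronglyMeasurable
    (ae_of_all _ fun x => gapDensity_nonneg ⟨measureReal_nonneg, measureReal_le_one⟩)).1 ?_
  rw [lintegral_gapDensity_cdf hn hf i]
  exact (lintegral_ofReal_ne_top_iff_integrable
    (integrable_max_sub_highestCompetingBid hn hf hfi i).aestronglyMeasurable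
    (ae_of_all _ fun x => le_max_right _ _)).2 (integrable_max_sub_highestCompetingBid hn hf hfi i)

/-- The expected gap between the bid of an advertiser and the highest competing bid. -/
lemma integral_max_sub_highestCompetingBid (hn : 2 ≤ n) (hf : Measurable f)
    (hfi : Integrable f P) (i : Fin n) :
    ∫ ω, max (f (ω i) - highestCompetingBid (fun j => f (ω j)) i) 0
        ∂(Measure.pi fun _ : Fin n => P)
      = ∫ x, gapDensity n (P.real {p | f p ≤ x}) := by
  have hnn : ∀ ω : Fin n → Ω,
      0 ≤ max (f (ω i) - highestCompetingBid (fun j => f (ω j)) i) 0 := fun ω => le_max_right _ _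
  rw [integral_eq_lintegral_of_nonneg_ae (ae_of_all _ hnn)
      (integrable_max_sub_highestCompetingBid hn hf hfi i).aestronglyMeasurable,
    integral_eq_lintegral_of_nonneg_ae
      (ae_of_all _ fun x => gapDensity_nonneg ⟨measureReal_nonneg, measureReal_le_one⟩)
      measurable_gapDensity_cdf.aestronglyMeasurable, lintegral_gapDensity_cdf hn hf i]

end Expectation

lemma integrable_noise_mul_winProb {P : Measure (ℝ × ℝ)} [IsProbabilityMeasure P]
    (h1 : Integrable (fun p => p.1) P) (h2 : Integrable (fun p => p.2) P) (i : Fin n) :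
    Integrable (fun ω : Fin n → ℝ × ℝ => ((ω i).2 - (ω i).1) * winProb (fun j => (ω j).1) i)
      (Measure.pi fun _ => P) := by
  have h : Integrable (fun ω : Fin n → ℝ × ℝ => (ω i).2 - (ω i).1) (Measure.pi fun _ => P) :=
    integrable_comp_eval (μ := fun _ => P) (f := fun p : ℝ × ℝ => p.2 - p.1) (h2.sub h1)
  refine h.mul_bdd (c := 1) (Measurable.aestronglyMeasurable ?_)
    (ae_of_all _ fun ω => abs_winProb_le _ i)
  exact (measurable_winProb i).comp
    (measurable_pi_lambda _ fun j => measurable_fst.comp (measurable_pi_apply j))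

/-- The winning probability is a bounded function of the initial estimates. With the competitors
fixed it depends only on the own initial estimate, to which the noise is orthogonal. -/
lemma integral_noise_mul_winProb {P : Measure (ℝ × ℝ)} [IsProbabilityMeasure P] {a b : ℝ}
    (hP : IsLocalRefinement P a b) (h1 : Integrable (fun p => p.1) P)
    (h2 : Integrable (fun p => p.2) P) (i : Fin n) :
    ∫ ω, ((ω i).2 - (ω i).1) * winProb (fun j => (ω j).1) i
      ∂(Measure.pi fun _ : Fin n => P) = 0 := by
  obtain ⟨m, rfl⟩ : ∃ m, n = m + 1 := ⟨n - 1, by have := i.2; omega⟩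
  have hint := integrable_noise_mul_winProb h1 h2 i
  have mp := (measurePreserving_piFinSuccAbove (fun _ : Fin (m + 1) => P) i).symm
  -- Coordinate `i` is split off, and the inner integral runs over it with the other pairs `w`
  -- fixed.
  rw [← mp.integral_comp', integral_prod_symm]
  · rw [← integral_zero (Fin m → ℝ × ℝ) ℝ]
    congr 1
    ext w
    have hm : Measurable fun v : ℝ => winProb
        (fun j => i.insertNth (α := fun _ => ℝ) v (fun k => (w k).1) j) i := by
      refine (measurable_winProb i).comp (measurable_pi_lambda _ fun j => ?_)
      rcases Fin.eq_self_or_eq_succAbove i j with rfl | ⟨k, rfl⟩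
      · simpa using measurable_id'
      · simp
    rw [← hP.integral_eq_zero _ hm ⟨1, fun v => abs_winProb_le _ i⟩]
    congr 1
    ext p
    have e : (fun j => ((i.insertNth (α := fun _ => ℝ × ℝ) p w) j).1)
        = fun j => i.insertNth (α := fun _ => ℝ) p.1 (fun k => (w k).1) j := by
      ext j
      rcases Fin.eq_self_or_eq_succAbove i j with rfl | ⟨k, rfl⟩ <;> simp
    simp only [MeasurableEquiv.piFinSuccAbove_symm_apply, Fin.insertNthEquiv, Equiv.coe_fn_mk]
    rw [e]
    simp [mul_comm]
  · exact (mp.integrable_comp_emb (MeasurableEquiv.measurableEmbedding _)).2 hint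

lemma dataValue_eq {μ : Measure ℝ} [IsProbabilityMeasure μ] {Q : Kernel ℝ ℝ} [IsMarkovKernel Q]
    {a b : ℝ} (hn : 2 ≤ n) (hP : IsLocalRefinement (μ ⊗ₘ Q) a b)
    (h1 : Integrable (fun p => p.1) (μ ⊗ₘ Q)) (h2 : Integrable (fun p => p.2) (μ ⊗ₘ Q))
    (i : Fin n) :
    dataValue n μ Q i = ∫ x in Icc a b, (gapDensity n ((μ ⊗ₘ Q).real {p | p.2 ≤ x})
      - gapDensity n ((μ ⊗ₘ Q).real {p | p.1 ≤ x})) := by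
  unfold dataValue payoffWithData payoffWithoutData estimatesLaw
  simp_rw [secondPricePayoff_self hn, secondPricePayoff_eq_add hn (fun j => Prod.snd _)]
  rw [integral_add (integrable_max_sub_highestCompetingBid hn measurable_fst h1 i)
      (integrable_noise_mul_winProb h1 h2 i), integral_noise_mul_winProb hP h1 h2 i, add_zero,
    integral_max_sub_highestCompetingBid hn measurable_fst h1 i,
    integral_max_sub_highestCompetingBid hn measurable_snd h2 i,
    ← integral_sub (integrable_gapDensity_cdf hn measurable_snd h2)
      (integrable_gapDensity_cdf hn measurable_fst h1)]
  refine (setIntegral_eq_integral_of_forall_compl_eq_zero fun x hx => ?_).symm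
  rw [cdf_eq_of_notMem hP (fun h => hx (Ioo_subset_Icc_self h)), sub_self]

end Auction

/-! ### Convexity and concavity of the gap density -/

/-- The graph lies strictly below its tangent at `q`: by the mean value theorem the chord slope is
`φ' c` for some `c` strictly between `p` and `q`, and `φ'` decreases strictly. -/
lemma mul_sub_lt_of_strictAntiOn_deriv {φ φ' : ℝ → ℝ} {s : Set ℝ} (hs : s.OrdConnected)
    (hd : ∀ x, HasDerivAt φ (φ' x) x) (hanti : StrictAntiOn φ' s) {p q : ℝ} (hp : p ∈ s)
    (hq : q ∈ s) (hpq : p ≠ q) : φ' q * (q - p) < φ q - φ p := by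
  have hc : Continuous φ := continuous_iff_continuousAt.2 fun x => (hd x).continuousAt
  rcases lt_or_gt_of_ne hpq with h | h
  · obtain ⟨c, hc, e⟩ := exists_hasDerivAt_eq_slope φ φ' h hc.continuousOn fun x _ => hd x
    have := hanti (hs.out hp hq (Ioo_subset_Icc_self hc)) hq hc.2
    rw [eq_div_iff (sub_pos.2 h).ne'] at e
    rw [← e]
    exact mul_lt_mul_of_pos_right this (sub_pos.2 h)
  · obtain ⟨c, hc, e⟩ := exists_hasDerivAt_eq_slope φ φ' h hc.continuousOn fun x _ => hd x
    have := hanti hq (hs.out hq hp (Ioo_subset_Icc_self hc)) hc.1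
    rw [eq_div_iff (sub_pos.2 h).ne'] at e
    nlinarith [mul_lt_mul_of_pos_right this (sub_pos.2 h)]

/-- The derivative of `gapDensity n`. -/
noncomputable def gapDensityDeriv (n : ℕ) (p : ℝ) : ℝ :=
  (n - 1 : ℝ) * p ^ (n - 2) - n * p ^ (n - 1)

section GapDensity

variable {n : ℕ}

lemma hasDerivAt_gapDensity (hn : 3 ≤ n) (p : ℝ) :
    HasDerivAt (gapDensity n) (gapDensityDeriv n p) p := by
  obtain ⟨m, rfl⟩ := Nat.exists_eq_add_of_le' hn
  have h := (hasDerivAt_pow (m + 2) p).mul ((hasDerivAt_id p).const_sub 1)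
  refine h.congr_deriv ?_
  simp only [gapDensityDeriv, show m + 3 - 2 = m + 1 from rfl, show m + 3 - 1 = m + 2 from rfl,
    show m + 2 - 1 = m + 1 from rfl, id]
  push_cast
  ring

lemma continuous_gapDensity : Continuous (gapDensity n) := by
  unfold gapDensity
  fun_prop

lemma continuous_gapDensityDeriv : Continuous (gapDensityDeriv n) := by
  unfold gapDensityDeriv
  fun_prop

/-- The factored form shows the sign change at `p = (n - 2) / n`, which is positive because `n ≥ 3`.
-/
lemma deriv_gapDensityDeriv (hn : 3 ≤ n) (p : ℝ) :
    deriv (gapDensityDeriv n) p = p ^ (n - 3) * ((n - 1 : ℝ) * ((n - 2 : ℝ) - n * p)) := by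
  obtain ⟨m, rfl⟩ := Nat.exists_eq_add_of_le' hn
  have h := (((hasDerivAt_pow (m + 1) p).const_mul ((m + 3 : ℕ) - 1 : ℝ))).sub
    ((hasDerivAt_pow (m + 2) p).const_mul ((m + 3 : ℕ) : ℝ))
  refine (h.congr_deriv ?_).deriv
  simp only [show m + 3 - 3 = m from rfl, show m + 2 - 1 = m + 1 from rfl,
    show m + 1 - 1 = m from rfl]
  push_cast
  ring

lemma strictAntiOn_gapDensityDeriv (hn : 3 ≤ n) :
    StrictAntiOn (gapDensityDeriv n) (Icc ((n - 2) / n) 1) := by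
  have h3 : (3 : ℝ) ≤ n := by exact_mod_cast hn
  refine strictAntiOn_of_deriv_neg (convex_Icc _ _) continuous_gapDensityDeriv.continuousOn
    fun p hp => ?_
  rw [interior_Icc] at hp
  have h0 : 0 < p := lt_of_le_of_lt (div_nonneg (by linarith) (by linarith)) hp.1
  have h1 := (div_lt_iff₀ (by linarith)).1 hp.1
  rw [deriv_gapDensityDeriv hn]
  exact mul_neg_of_pos_of_neg (pow_pos h0 _)
    (mul_neg_of_pos_of_neg (by linarith) (by linarith))

lemma strictMonoOn_gapDensityDeriv (hn : 3 ≤ n) :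
    StrictMonoOn (gapDensityDeriv n) (Icc 0 ((n - 2) / n)) := by
  have h3 : (3 : ℝ) ≤ n := by exact_mod_cast hn
  refine strictMonoOn_of_deriv_pos (convex_Icc _ _) continuous_gapDensityDeriv.continuousOn
    fun p hp => ?_
  rw [interior_Icc] at hp
  have h1 := (lt_div_iff₀ (by linarith)).1 hp.2
  rw [deriv_gapDensityDeriv hn]
  exact mul_pos (pow_pos hp.1 _) (mul_pos (by linarith) (by linarith))

end GapDensity

/-! ### Refinement signals as local spreads, and the sign of the value of the data -/

namespace IsRefinementSignal

variable {vstar δ r : ℝ} {Q : Kernel ℝ ℝ}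

lemma ae_local (hQ : IsRefinementSignal vstar δ r Q) (v : ℝ) :
    ∀ᵐ x ∂(Q v), x = v ∨ (v ∈ Icc (vstar - δ) (vstar + δ) ∧ |x - v| ≤ r) := by
  by_cases hv : v ∈ Icc (vstar - δ) (vstar + δ)
  · obtain ⟨ν, _, hr, -, -, e⟩ := hQ.inside v hv
    rw [e, ae_map_iff (by fun_prop) (by measurability)]
    filter_upwards [hr] with x hx
    exact Or.inr ⟨hv, by simpa [abs_le] using hx⟩
  · rw [hQ.outside v hv, ae_dirac_eq]
    exact Or.inl rfl

lemma integral_sub_eq_zero (hQ : IsRefinementSignal vstar δ r Q) (v : ℝ) :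
    ∫ x, (x - v) ∂(Q v) = 0 := by
  by_cases hv : v ∈ Icc (vstar - δ) (vstar + δ)
  · obtain ⟨ν, _, -, h0, -, e⟩ := hQ.inside v hv
    rw [e, integral_map (by fun_prop) (by fun_prop)]
    simpa using h0
  · rw [hQ.outside v hv, integral_dirac, sub_self]

lemma not_ae_eq (hQ : IsRefinementSignal vstar δ r Q) {v : ℝ}
    (hv : v ∈ Icc (vstar - δ) (vstar + δ)) : ¬ ∀ᵐ x ∂(Q v), x = v := by
  obtain ⟨ν, _, -, -, hne, e⟩ := hQ.inside v hv
  rw [e, ae_map_iff (by fun_prop) (by measurability)]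
  intro h
  apply hne
  have h' : (fun x : ℝ => x) =ᵐ[ν] fun _ => 0 := by
    filter_upwards [h] with x hx
    linarith
  have := Measure.map_congr (mβ := inferInstance) h'
  rwa [Measure.map_id', Measure.map_const, measure_univ, one_smul] at this

lemma ae_compProd_local {μ : Measure ℝ} (hr : 0 ≤ r) (hQ : IsRefinementSignal vstar δ r Q) :
    ∀ᵐ p ∂(μ ⊗ₘ Q), |p.2 - p.1| ≤ r ∧
      (p.2 = p.1 ∨ p.1 ∈ Icc (vstar - δ) (vstar + δ)) := by
  refine Measure.ae_compProd_of_ae_ae ?_ (ae_of_all _ fun v => ?_)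
  · refine (measurableSet_le (measurable_snd.sub measurable_fst).abs measurable_const).inter
      ((measurableSet_eq_fun measurable_snd measurable_fst).union
        (measurable_fst measurableSet_Icc))
  · filter_upwards [hQ.ae_local v] with x hx
    rcases hx with rfl | ⟨h, h'⟩
    · simpa using hr
    · exact ⟨h', Or.inr h⟩

variable {μ : Measure ℝ} [IsProbabilityMeasure μ] [IsMarkovKernel Q]

lemma integrable_sub (hr : 0 ≤ r) (hQ : IsRefinementSignal vstar δ r Q) :
    Integrable (fun p => p.2 - p.1) (μ ⊗ₘ Q) := by
  refine Integrable.of_bound (by fun_prop) r ?_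
  filter_upwards [hQ.ae_compProd_local hr] with p hp using hp.1

lemma integrable_fst (hmean : Integrable (fun v : ℝ => v) μ) :
    Integrable (fun p => p.1) (μ ⊗ₘ Q) := by
  have : Integrable (fun v : ℝ => v) ((μ ⊗ₘ Q).map Prod.fst) := by
    rwa [← Measure.fst, Measure.fst_compProd]
  exact this.comp_measurable measurable_fst

lemma integrable_snd (hr : 0 ≤ r) (hQ : IsRefinementSignal vstar δ r Q)
    (hmean : Integrable (fun v : ℝ => v) μ) : Integrable (fun p => p.2) (μ ⊗ₘ Q) := by
  refine ((hQ.integrable_sub hr).add (integrable_fst hmean)).congr (ae_of_all _ fun p => ?_)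
  simp

/-- A refined estimate starts within `δ < r` of `vstar` and moves by at most `r`, so it stays
strictly within `2 * r`. -/
lemma isLocalRefinement (hr : 0 < r) (hδ : δ < r) (hQ : IsRefinementSignal vstar δ r Q) :
    IsLocalRefinement (μ ⊗ₘ Q) (vstar - 2 * r) (vstar + 2 * r) where
  local_ae := by
    filter_upwards [hQ.ae_compProd_local hr.le] with p hp
    refine hp.2.imp_right fun h => ?_
    have := abs_le.1 hp.1
    constructor <;> constructor <;> linarith [h.1, h.2]
  integral_eq_zero g hg := by
    rintro ⟨C, hC⟩
    have hi : Integrable (fun p => g p.1 * (p.2 - p.1)) (μ ⊗ₘ Q) :=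
      (hQ.integrable_sub hr.le).bdd_mul (c := C)
        (hg.comp measurable_fst).aestronglyMeasurable (ae_of_all _ fun p => hC p.1)
    rw [Measure.integral_compProd hi]
    simp_rw [integral_const_mul, hQ.integral_sub_eq_zero, mul_zero, integral_zero]

/-- A point of the support gives `[vstar - δ, vstar + δ]` positive mass, and at every estimate in it
the noise is nondegenerate. -/
lemma not_ae_compProd_eq (hδ : 0 < δ) (hs : vstar ∈ μ.support)
    (hQ : IsRefinementSignal vstar δ r Q) : ¬ ∀ᵐ p ∂(μ ⊗ₘ Q), p.2 = p.1 := by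
  intro h
  have h' := Measure.ae_ae_of_ae_compProd h
  have hpos := (Measure.mem_support_iff_forall vstar).1 hs _
    (Icc_mem_nhds (sub_lt_self vstar hδ) (lt_add_of_pos_right vstar hδ))
  refine hpos.ne' (measure_mono_null (fun v hv => ?_) (ae_iff.1 h'))
  exact hQ.not_ae_eq hv

lemma compProd_real_fst_le (x : ℝ) : (μ ⊗ₘ Q).real {p | p.1 ≤ x} = μ.real (Iic x) := by
  have h := map_measureReal_apply (μ := μ ⊗ₘ Q) measurable_fst (measurableSet_Iic (a := x))
  rw [← Measure.fst, Measure.fst_compProd] at h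
  exact h.symm

lemma dataValue_pos {n : ℕ} (hn : 3 ≤ n) (hmean : Integrable (fun v : ℝ => v) μ)
    (hr : 0 < r) (hδ : 0 < δ) (hδr : δ < r) (hs : vstar ∈ μ.support)
    (hQ : IsRefinementSignal vstar δ r Q)
    (hF : ((n : ℝ) - 2) / n ≤ μ.real (Iic (vstar - 2 * r))) (i : Fin n) :
    0 < dataValue n μ Q i := by
  have hP := hQ.isLocalRefinement (μ := μ) hr hδr
  have h1 := integrable_fst (Q := Q) hmean
  have h2 := hQ.integrable_snd hr.le hmean
  rw [dataValue_eq (by omega) hP h1 h2]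
  have hsub := Icc_subset_Icc hF
    (measureReal_le_one (μ := μ) (s := Iic (vstar + 2 * r)))
  have hanti := (strictAntiOn_gapDensityDeriv hn).mono hsub
  refine setIntegral_comp_cdf_sub_pos (by linarith) hP (hQ.not_ae_compProd_eq hδ hs)
    (continuous_gapDensity (n := n)) (continuous_gapDensityDeriv (n := n)) ?_ ?_
  · simpa only [compProd_real_fst_le] using hanti.antitoneOn
  · simp only [compProd_real_fst_le]
    exact fun p hp q hq => mul_sub_lt_of_strictAntiOn_deriv ordConnected_Icc
      (hasDerivAt_gapDensity hn) hanti hp hq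

lemma dataValue_neg {n : ℕ} (hn : 3 ≤ n) (hmean : Integrable (fun v : ℝ => v) μ)
    (hr : 0 < r) (hδ : 0 < δ) (hδr : δ < r) (hs : vstar ∈ μ.support)
    (hQ : IsRefinementSignal vstar δ r Q)
    (hF : μ.real (Iic (vstar + 2 * r)) ≤ ((n : ℝ) - 2) / n) (i : Fin n) :
    dataValue n μ Q i < 0 := by
  have hP := hQ.isLocalRefinement (μ := μ) hr hδr
  have h1 := integrable_fst (Q := Q) hmean
  have h2 := hQ.integrable_snd hr.le hmean
  rw [dataValue_eq (by omega) hP h1 h2, ← neg_pos, ← integral_neg]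
  have hsub := Icc_subset_Icc (measureReal_nonneg (μ := μ) (s := Iic (vstar - 2 * r))) hF
  -- Below the inflection level `-gapDensity n` is strictly concave, so the positivity result
  -- applies to it.
  have hanti := ((strictMonoOn_gapDensityDeriv hn).mono hsub).neg
  have := setIntegral_comp_cdf_sub_pos (by linarith) hP (hQ.not_ae_compProd_eq hδ hs)
    (continuous_gapDensity (n := n)).neg (continuous_gapDensityDeriv (n := n)).neg
    (by rw [compProd_real_fst_le, compProd_real_fst_le]; exact hanti.antitoneOn)
    (by
      simp only [compProd_real_fst_le]
      exact fun p hp q hq => mul_sub_lt_of_strictAntiOn_deriv ordConnected_Icc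
        (fun x => (hasDerivAt_gapDensity hn x).neg) hanti hp hq)
  refine this.trans_eq (integral_congr_ae (ae_of_all _ fun x => ?_))
  simp only [Pi.neg_apply]
  ring

end IsRefinementSignal

/-! ### The threshold as a quantile -/

/-- The jump of the cdf at `x` is the mass of `{x}`. -/
lemma continuous_real_Iic {μ : Measure ℝ} [IsProbabilityMeasure μ] (hcont : ∀ x : ℝ, μ {x} = 0) :
    Continuous fun x => μ.real (Iic x) := by
  have : NullSingletonClass μ := ⟨hcont⟩
  simp_rw [← cdf_eq_real]
  refine continuous_iff_continuousAt.2 fun x => ?_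
  rw [(monotone_cdf μ).continuousAt_iff_leftLim_eq_rightLim, (cdf μ).rightLim_eq]
  have h := (cdf μ).measure_singleton x
  rw [measure_cdf, hcont x, eq_comm, ENNReal.ofReal_eq_zero] at h
  exact le_antisymm ((monotone_cdf μ).leftLim_le le_rfl) (by linarith)

lemma exists_real_Iic_eq {μ : Measure ℝ} [IsProbabilityMeasure μ] (hcont : ∀ x : ℝ, μ {x} = 0)
    {p : ℝ} (h0 : 0 < p) (h1 : p < 1) : ∃ x, μ.real (Iic x) = p := by
  have hb := tendsto_cdf_atBot μ
  have ht := tendsto_cdf_atTop μ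
  obtain ⟨x, hx⟩ := (hb.eventually_lt_const h0).exists
  obtain ⟨y, hy⟩ := (ht.eventually_const_lt h1).exists
  rw [cdf_eq_real] at hx hy
  exact mem_range_of_exists_le_of_exists_ge (continuous_real_Iic hcont) ⟨x, hx.le⟩ ⟨y, hy.le⟩

theorem mainTheorem8 (n : ℕ) (hn : 3 ≤ n) (μ : Measure ℝ) [IsProbabilityMeasure μ]
    (hcont : ∀ x : ℝ, μ {x} = 0)
    (hmean : Integrable (fun v : ℝ => v) μ) :
    ∃ τ : ℝ, τ ∈ interior (convexHull ℝ μ.support) ∧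
      (μ.support.OrdConnected → τ ∈ interior μ.support) ∧
      ∀ vstar ∈ μ.support, ∃ r : ℝ, 0 < r ∧
        ∀ δ : ℝ, 0 < δ → δ < r → ∀ (Q : Kernel ℝ ℝ) [IsMarkovKernel Q],
          IsRefinementSignal vstar δ r Q →
            (τ < vstar → ∀ i : Fin n, 0 < dataValue n μ Q i) ∧
            (vstar < τ → ∀ i : Fin n, dataValue n μ Q i < 0) := by
  have h3 : (3 : ℝ) ≤ n := by exact_mod_cast hn
  have hp0 : 0 < ((n : ℝ) - 2) / n := div_pos (by linarith) (by linarith)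
  have hp1 : ((n : ℝ) - 2) / n < 1 := (div_lt_one (by linarith)).2 (by linarith)
  obtain ⟨τ, hτ⟩ := exists_real_Iic_eq hcont hp0 hp1
  have hmono : Monotone fun x => μ.real (Iic x) := fun x y h =>
    measureReal_mono (Iic_subset_Iic.2 h)
  have : NullSingletonClass μ := ⟨hcont⟩
  -- The level of `τ` lies strictly between `0` and `1`, so there is mass, hence a support point,
  -- strictly on each side of `τ`.
  have hlo : 0 < μ (Iio τ) := by
    rw [measure_congr Iio_ae_eq_Iic]
    exact (ENNReal.toReal_pos_iff.1 (hp0.trans_eq hτ.symm)).1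
  have hhi : 0 < μ (Ioi τ) := by
    have h : 0 < μ.real (Iic τ)ᶜ := by
      rw [probReal_compl_eq_one_sub measurableSet_Iic, hτ]
      linarith
    rw [compl_Iic] at h
    exact (ENNReal.toReal_pos_iff.1 h).1
  obtain ⟨s, hsτ, hs⟩ := Measure.nonempty_inter_support_of_pos hlo
  obtain ⟨t, htτ, ht⟩ := Measure.nonempty_inter_support_of_pos hhi
  have hint : ∀ A : Set ℝ, A.OrdConnected → μ.support ⊆ A → τ ∈ interior A := fun A hA hsub =>
    interior_mono (Ioo_subset_Icc_self.trans (hA.out (hsub hs) (hsub ht)))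
      (by rw [interior_Ioo]; exact ⟨hsτ, htτ⟩)
  refine ⟨τ, hint _ (convex_convexHull ℝ _).ordConnected (subset_convexHull ℝ _),
    fun h => hint _ h subset_rfl, fun vstar hv => ?_⟩
  rcases lt_trichotomy τ vstar with h | h | h
  -- This `r` makes `vstar - 2 * r = τ`, so the whole affected interval lies above the quantile,
  -- where the gap density is concave.
  · refine ⟨(vstar - τ) / 2, by linarith, fun δ hδ hδr Q _ hQ => ⟨fun _ i => ?_,
      fun h' => absurd h' h.not_gt⟩⟩
    refine hQ.dataValue_pos hn hmean (by linarith) hδ hδr hv ?_ i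
    rw [← hτ]
    exact hmono (by linarith)
  -- At `vstar = τ` both claims are vacuous and any `r` will do.
  · exact ⟨1, one_pos, fun δ _ _ Q _ _ => ⟨fun h' => absurd h h'.ne,
      fun h' => absurd h h'.ne'⟩⟩
  · refine ⟨(τ - vstar) / 2, by linarith, fun δ hδ hδr Q _ hQ => ⟨fun h' => absurd h' h.not_gt,
      fun _ i => ?_⟩⟩
    refine hQ.dataValue_neg hn hmean (by linarith) hδ hδr hv ?_ i
    rw [← hτ]
    exact hmono (by linarith)
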